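/- Let $n,m\ge 0$ be integers and $q=\max(n,m)$. In one use of the symmetric two-user deterministic interference channel with operating point $[n,m]$, the two sending terminals send bit vectors $X_1,X_2\in\mathbb F_2^q$ and the two listening terminals $j=1,2$ observe $$Y_j=\sum_{k=1}^{2}\mathbf S^{\,q-n_{kj}}X_k\quad(\text{over }\mathbb F_2),\qquad n_{jj}=n,\quad n_{kj}=m\ (k\ne j),$$ where $\mathbf S$ is the $q\times q$ down-shift matrix. There are two independent, uniformly distributed messages $W_1,W_2$; receiver $k$ has to decode $W_k$. Half-duplex feedback: each of the $N$ time slots is used, according to a fixed schedule known to all terminals, either by the forward channel (transmitters send, receivers listen) or by the feedback channel (receivers send, transmitters listen), and both are interference channels as above with the same operating point $[n,m]$. The signal sent by transmitter $k$ in a forward slot is a function of $W_k$ and of what transmitter $k$ has observed in earlier feedback slots; the signal sent by receiver $k$ in a feedback slot is a function of what receiver $k$ has observed in earlier forward slots; receiver $k$ decodes $W_k$ from its observations in all forward slots. Rates are in bits per time slot, forward and feedback slots both counted. For $t\in[0,1]$ the capacity region at forward fraction $t$ is the closure of the set of rate pairs $(R_1,R_2)$ for which there are such codes with at least $2^{NR_k}$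 messages for user $k$, with error probability tending to $0$ and with the fraction of forward slots tending to $t$ as $N\to\infty$. The half-duplex feedback sum capacity $C^{\mathrm{HD}}_{\mathrm{sum}}(n,m)$ is the supremum of $R_1+R_2$ over these regions and over all $t\in[0,1]$. The sum capacity without feedback $C_{\mathrm{sum}}(n,m)$ is the supremum of $R_1+R_2$ over the capacity region of the forward channel used in every slot, where each transmitter's signals depend only on its own message. Theorem. If $m\ge\frac23 n$, then feedback does not increase the sum capacity: $$C^{\mathrm{HD}}_{\mathrm{sum}}(n,m)=C_{\mathrm{sum}}(n,m).$$ -/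

import Mathlib

open Filter
open scoped NNReal ENNReal

namespace DetIC

/-- A signal: the bits sent (or received) in one time slot on `q` levels; index `0` is the most
significant bit. -/
abbrev Signal (q : ℕ) : Type := Fin q → ZMod 2

/-- The `q × q` shift matrix of a link with `l ≤ q` levels: it moves a signal down by `q - l`
levels, so that only its `l` most significant bits are observed. -/
def shiftMatrix (q l : ℕ) : Matrix (Fin q) (Fin q) (ZMod 2) :=
  Matrix.of fun i j => if (i : ℕ) = (q - l) + (j : ℕ) then 1 else 0

/-- The symmetric two-user deterministic interference channel with operating point `[n, m]`:
direct links carry `n` levels, cross links carry `m` levels, and `q = max n m`.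
`channel n m x j` is what terminal `j` on the listening side observes when the two terminals
`k = 0, 1` on the sending side send `x k`. By symmetry of the link capacities the same map
describes the forward channel (transmitters to receivers) and the feedback channel (receivers to
transmitters). -/
def channel (n m : ℕ) (x : Fin 2 → Signal (max n m)) : Fin 2 → Signal (max n m) :=
  fun j => ∑ k : Fin 2, (shiftMatrix (max n m) (if k = j then n else m)).mulVec (x k)

/-- A pair of messages, one for each user. -/
abbrev Messages (M : Fin 2 → ℕ) : Type := ∀ k : Fin 2, Fin (M k)

/-- Probability that at least one of the two messages is estimated wrongly, when the messages are
independent and uniformly distributed and `est` maps the sent messages to the estimates. -/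
noncomputable def errorProb {M : Fin 2 → ℕ} (est : Messages M → Messages M) : ℝ :=
  (Finset.univ.filter fun w => est w ≠ w).card / (Fintype.card (Messages M) : ℝ)

/-- A block code of length `N` without feedback: user `k` encodes its message only. -/
structure NoFeedbackCode (n m N : ℕ) (M : Fin 2 → ℕ) where
  /-- encoder of transmitter `k`: the signal sent in each time slot -/
  enc : ∀ k : Fin 2, Fin (M k) → Fin N → Signal (max n m)
  /-- decoder of receiver `k` -/
  dec : ∀ k : Fin 2, (Fin N → Signal (max n m)) → Fin (M k)

namespace NoFeedbackCode

variable {n m N : ℕ} {M : Fin 2 → ℕ}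

/-- The messages estimated by the receivers when `w` is sent. -/
def estimate (c : NoFeedbackCode n m N M) (w : Messages M) : Messages M :=
  fun k => c.dec k fun i => channel n m (fun l => c.enc l (w l) i) k

end NoFeedbackCode

/-- A half-duplex feedback code of length `N`. Each of the `N` time slots is used either by the
forward channel or by the feedback channel, according to a schedule known to all terminals.
(Only the values of `isForward`, `enc`, `fb` at slots `i < N` matter.) -/
structure HalfDuplexCode (n m N : ℕ) (M : Fin 2 → ℕ) where
  /-- the slots in which the forward channel is used; the others are feedback slots -/
  isForward : ℕ → Bool
  /-- encoder of transmitter `k` in slot `i`: a function of its own message and of what this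
  transmitter has observed on the feedback channel in slots `0, …, i - 1` -/
  enc : ∀ (k : Fin 2) (i : ℕ), Fin (M k) → (Fin i → Signal (max n m)) → Signal (max n m)
  /-- signal fed back by receiver `k` in slot `i`: a function of what this receiver has
  observed on the forward channel in slots `0, …, i - 1` -/
  fb : ∀ (_ : Fin 2) (i : ℕ), (Fin i → Signal (max n m)) → Signal (max n m)
  /-- decoder of receiver `k`, applied to its observations in all `N` slots -/
  dec : ∀ k : Fin 2, (Fin N → Signal (max n m)) → Fin (M k)

namespace HalfDuplexCode

variable {n m N : ℕ} {M : Fin 2 → ℕ}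

/-- What the terminals have observed during the first `i` slots when the messages are `w`:
`(c.trace w i).1 k` is the record of transmitter `k`, `(c.trace w i).2 k` that of receiver `k`.
In a forward slot the transmitters send and the receivers listen, in a feedback slot it is the
other way round; the entry `0` in a slot in which a terminal does not listen is a placeholder. -/
def trace (c : HalfDuplexCode n m N M) (w : Messages M) :
    (i : ℕ) → (Fin 2 → Fin i → Signal (max n m)) × (Fin 2 → Fin i → Signal (max n m))
  | 0 => (fun _ => Fin.elim0, fun _ => Fin.elim0)
  | i + 1 =>
    let past := trace c w i
    let toRx : Fin 2 → Signal (max n m) :=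
      if c.isForward i then channel n m (fun k => c.enc k i (w k) (past.1 k)) else 0
    let toTx : Fin 2 → Signal (max n m) :=
      if c.isForward i then 0 else channel n m (fun k => c.fb k i (past.2 k))
    (fun k => Fin.snoc (α := fun _ => Signal (max n m)) (past.1 k) (toTx k),
      fun k => Fin.snoc (α := fun _ => Signal (max n m)) (past.2 k) (toRx k))

/-- The messages estimated by the receivers when `w` is sent. -/
def estimate (c : HalfDuplexCode n m N M) (w : Messages M) : Messages M :=
  fun k => c.dec k ((c.trace w N).2 k)

/-- The fraction of the `N` time slots in which the forward channel is used. -/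
noncomputable def forwardFraction (c : HalfDuplexCode n m N M) : ℝ :=
  ((Finset.range N).filter fun i => c.isForward i = true).card / (N : ℝ)

end HalfDuplexCode

/-- The rate pair `R` (in bits per time slot) is achievable without feedback: for all large block
lengths `N` there are codes with at least `2 ^ (N R k)` messages for user `k` whose error
probability tends to `0`. -/
def NoFeedbackAchievable (n m : ℕ) (R : Fin 2 → ℝ≥0) : Prop :=
  ∀ ε : ℝ, 0 < ε → ∀ᶠ N : ℕ in atTop, ∃ (M : Fin 2 → ℕ) (c : NoFeedbackCode n m N M),
    (∀ k, (2 : ℝ) ^ ((N : ℝ) * (R k : ℝ)) ≤ (M k : ℝ)) ∧ errorProb c.estimate ≤ ε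

/-- The rate pair `R` is achievable with half-duplex feedback when the forward channel is used for
(asymptotically) the fraction `t` of the time. Rates are in bits per time slot, where forward and
feedback slots both count. -/
def HalfDuplexAchievable (n m : ℕ) (t : ℝ) (R : Fin 2 → ℝ≥0) : Prop :=
  ∀ ε : ℝ, 0 < ε → ∀ᶠ N : ℕ in atTop, ∃ (M : Fin 2 → ℕ) (c : HalfDuplexCode n m N M),
    (∀ k, (2 : ℝ) ^ ((N : ℝ) * (R k : ℝ)) ≤ (M k : ℝ)) ∧ errorProb c.estimate ≤ ε ∧
      |c.forwardFraction - t| ≤ ε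

/-- Capacity region without feedback. -/
def noFeedbackRegion (n m : ℕ) : Set (Fin 2 → ℝ≥0) :=
  closure {R | NoFeedbackAchievable n m R}

/-- Capacity region with half-duplex feedback and forward fraction `t`. -/
def halfDuplexRegion (n m : ℕ) (t : ℝ) : Set (Fin 2 → ℝ≥0) :=
  closure {R | HalfDuplexAchievable n m t R}

/-- The supremum of `R₁ + R₂` over a region of rate pairs, as an extended nonnegative real. -/
noncomputable def sumCapacity (𝓡 : Set (Fin 2 → ℝ≥0)) : ℝ≥0∞ :=
  ⨆ R ∈ 𝓡, ((R 0 + R 1 : ℝ≥0) : ℝ≥0∞)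

/-- Sum capacity without feedback. -/
noncomputable def noFeedbackSumCapacity (n m : ℕ) : ℝ≥0∞ :=
  sumCapacity (noFeedbackRegion n m)

/-- Sum capacity with half-duplex feedback: the time-sharing parameter `t ∈ [0, 1]` can be
chosen freely. -/
noncomputable def halfDuplexSumCapacity (n m : ℕ) : ℝ≥0∞ :=
  ⨆ t ∈ Set.Icc (0 : ℝ) 1, sumCapacity (halfDuplexRegion n m t)

end DetIC

/-! Both capacities equal min(2n, max(n,m) + (n-m)⁺) when 3m ≥ 2n. The upper bound survives feedback
because it only counts the bits that determine a deterministic run. In a forward or a feedback slot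
alike, at most n bits cross from {transmitter j, receiver k} to {transmitter k, receiver j}; given
W_k they fix what receiver j observes, so R_j ≤ n (`card_correct_le_cut`). Receiver 0's record,
together with the (n-m)⁺ levels of X₁ hidden from it, fixes the whole run: W₀ is decoded, then slot
by slot X₀ is recomputed and subtracted, which reveals X₁ and all feedback (`card_correct_le_sum`).

Codes without feedback are half-duplex codes with t = 1, so it remains to attain the bound without
feedback. Zero-error one-shot codes do this in three regimes. Where interference cannot be avoided,
the interfering bits also appear on levels where they arrive alone, so they can be learned there and
cancelled. -/

namespace DetIC

/-! ### Linear algebra of the shift channel -/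

/-- The contribution of a link with `l` levels, evaluated at level `i`. -/
theorem shiftMatrix_mulVec_apply {q l : ℕ} (x : Signal q) (i : Fin q) :
    (shiftMatrix q l).mulVec x i =
      if q - l ≤ (i : ℕ) then x ⟨i - (q - l), by omega⟩ else 0 := by
  simp only [shiftMatrix, Matrix.mulVec, dotProduct, Matrix.of_apply, ite_mul, one_mul, zero_mul]
  split_ifs with h
  · rw [Finset.sum_eq_single (⟨i - (q - l), by omega⟩ : Fin q)]
    · rw [if_pos]
      simp only
      omega
    · intro j _ hj
      rw [if_neg]
      intro h'
      apply hj
      ext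
      simp only
      omega
    · simp
  · apply Finset.sum_eq_zero
    intro j _
    rw [if_neg]
    omega

theorem channel_of_ne {n m : ℕ} (x : Fin 2 → Signal (max n m)) {j k : Fin 2} (h : j ≠ k) :
    channel n m x j =
      (shiftMatrix (max n m) n).mulVec (x j) + (shiftMatrix (max n m) m).mulVec (x k) := by
  fin_cases j <;> fin_cases k <;> simp [channel] at h ⊢
  exact add_comm _ _

theorem shiftMatrix_mulVec_congr {q l : ℕ} (hl : l ≤ q) {x y : Signal q}
    (h : ∀ i : Fin q, (i : ℕ) < l → x i = y i) :
    (shiftMatrix q l).mulVec x = (shiftMatrix q l).mulVec y := by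
  ext i
  rw [shiftMatrix_mulVec_apply, shiftMatrix_mulVec_apply]
  split_ifs with h'
  · exact h _ (by simp only; omega)
  · rfl

/-- A link determines the levels that it carries. -/
theorem eq_of_shiftMatrix_mulVec_eq {q l : ℕ} {x y : Signal q}
    (h : (shiftMatrix q l).mulVec x = (shiftMatrix q l).mulVec y) (i : Fin q) (hi : (i : ℕ) < l)
    (hl : l ≤ q) : x i = y i := by
  have := congrFun h ⟨i + (q - l), by omega⟩
  rw [shiftMatrix_mulVec_apply, shiftMatrix_mulVec_apply] at this
  simpa using this

/-- In the symmetric two-user channel, the signal received by `k` and the one sent by `k` determine,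
together with the levels of the other signal that are only seen at the other end, everything. -/
theorem channel_eq_of_eq {n m : ℕ} {x y : Fin 2 → Signal (max n m)} {j k : Fin 2} (h : j ≠ k)
    (hk : x k = y k) (hY : channel n m x k = channel n m y k)
    (hj : ∀ i : Fin (max n m), m ≤ (i : ℕ) → x j i = y j i) :
    channel n m x = channel n m y := by
  have hx : x j = y j := by
    rw [channel_of_ne x h.symm, channel_of_ne y h.symm, hk] at hY
    ext i
    rcases lt_or_ge (i : ℕ) m with hi | hi
    · exact eq_of_shiftMatrix_mulVec_eq (add_left_cancel hY) i hi (le_max_right _ _)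
    · exact hj i hi
  have : x = y := by
    funext l
    fin_cases j <;> fin_cases k <;> fin_cases l <;> simp_all
  rw [this]

theorem channel_apply_eq {n m : ℕ} {x y : Fin 2 → Signal (max n m)} {j k : Fin 2} (h : j ≠ k)
    (hk : x k = y k) (hj : ∀ i : Fin (max n m), (i : ℕ) < n → x j i = y j i) :
    channel n m x j = channel n m y j := by
  rw [channel_of_ne x h, channel_of_ne y h, hk,
    shiftMatrix_mulVec_congr (le_max_left n m) hj]

/-! ### Converse: counting correctly decoded message pairs -/

namespace HalfDuplexCode

variable {n m N : ℕ} {M : Fin 2 → ℕ}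

/-- The signal sent by transmitter `k` in slot `i`. -/
def input (c : HalfDuplexCode n m N M) (w : Messages M) (i : ℕ) (k : Fin 2) : Signal (max n m) :=
  c.enc k i (w k) ((c.trace w i).1 k)

/-- The signal fed back by receiver `k` in slot `i`. -/
def feedback (c : HalfDuplexCode n m N M) (w : Messages M) (i : ℕ) (k : Fin 2) :
    Signal (max n m) :=
  c.fb k i ((c.trace w i).2 k)

theorem trace_succ_fst (c : HalfDuplexCode n m N M) (w : Messages M) (i : ℕ) (k : Fin 2) :
    (c.trace w (i + 1)).1 k = Fin.snoc (α := fun _ => Signal (max n m)) ((c.trace w i).1 k)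
      (if c.isForward i then 0 else channel n m (c.feedback w i) k) := by
  simp only [trace]
  split_ifs <;> rfl

theorem trace_succ_snd (c : HalfDuplexCode n m N M) (w : Messages M) (i : ℕ) (k : Fin 2) :
    (c.trace w (i + 1)).2 k = Fin.snoc (α := fun _ => Signal (max n m)) ((c.trace w i).2 k)
      (if c.isForward i then channel n m (c.input w i) k else 0) := by
  simp only [trace]
  split_ifs <;> rfl

/-- The message and the record of user `k`, together with the levels of the signals of the other
transmitter that receiver `k` never sees, determine all records. -/
theorem trace_eq_of_snd_eq (c : HalfDuplexCode n m N M) {w w' : Messages M} {j k : Fin 2}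
    (h : j ≠ k) (hk : w k = w' k) (i : ℕ) (hY : (c.trace w i).2 k = (c.trace w' i).2 k)
    (hj : ∀ s < i, ∀ l : Fin (max n m), m ≤ (l : ℕ) → c.input w s j l = c.input w' s j l) :
    c.trace w i = c.trace w' i := by
  induction i with
  | zero => rfl
  | succ i ih =>
    rw [trace_succ_snd, trace_succ_snd, Fin.snoc_inj] at hY
    have ht := ih hY.1 fun s hs => hj s (by omega)
    have hf : c.feedback w i = c.feedback w' i := by
      funext l
      simp only [feedback, ht]
    -- Equal pasts and equal messages give equal signals of transmitter `k`; subtracting this signal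
    -- from the output at `k` exposes the common levels of the other one.
    have hx : c.isForward i = true → channel n m (c.input w i) = channel n m (c.input w' i) := by
      intro hi
      refine channel_eq_of_eq h ?_ (by simpa [hi] using hY.2) (hj i (by omega))
      simp only [input, ht, hk]
    refine Prod.ext (funext fun l => ?_) (funext fun l => ?_)
    · rw [trace_succ_fst, trace_succ_fst, ht, hf]
    · rw [trace_succ_snd, trace_succ_snd, ht]
      split_ifs with hi
      · rw [hx hi]
      · rfl

/-- The signal crossing from transmitter `j` or receiver `k` to the other two terminals over the
direct links in slot `i`. -/
def cutSignal (c : HalfDuplexCode n m N M) (j k : Fin 2) (w : Messages M) (i : ℕ) :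
    Signal (max n m) :=
  if c.isForward i then c.input w i j else c.feedback w i k

/-- The message of user `k` and what crosses the cut between transmitter `j`, receiver `k` and
transmitter `k`, receiver `j` over the direct links determine the records of the latter two. -/
theorem trace_eq_of_cutSignal_eq (c : HalfDuplexCode n m N M) {w w' : Messages M} {j k : Fin 2}
    (h : j ≠ k) (hk : w k = w' k) (i : ℕ)
    (hj : ∀ s < i, ∀ l : Fin (max n m), (l : ℕ) < n →
      c.cutSignal j k w s l = c.cutSignal j k w' s l) :
    (c.trace w i).1 k = (c.trace w' i).1 k ∧ (c.trace w i).2 j = (c.trace w' i).2 j := by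
  induction i with
  | zero => exact ⟨rfl, rfl⟩
  | succ i ih =>
    obtain ⟨h1, h2⟩ := ih fun s hs => hj s (by omega)
    have hi := hj i (by omega)
    rw [trace_succ_fst, trace_succ_fst, trace_succ_snd, trace_succ_snd, h1, h2]
    -- In a feedback slot only transmitter `k` hears something new, in a forward slot only receiver
    -- `j`. The other signal it hears comes from its own side of the cut and is already determined.
    cases hf : c.isForward i
    · simp only [cutSignal, hf, Bool.false_eq_true, if_false] at hi ⊢
      refine ⟨?_, trivial⟩
      rw [channel_apply_eq h.symm _ hi]
      simp only [feedback, h2]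
    · simp only [cutSignal, hf, if_true] at hi ⊢
      refine ⟨trivial, ?_⟩
      rw [channel_apply_eq h _ hi]
      simp only [input, h1, hk]

/-- The message pairs that are decoded correctly. -/
noncomputable def correct (c : HalfDuplexCode n m N M) : Finset (Messages M) :=
  Finset.univ.filter fun w => c.estimate w = w

theorem eq_of_mem_correct (c : HalfDuplexCode n m N M) {w w' : Messages M} {k : Fin 2}
    (hw : w ∈ c.correct) (hw' : w' ∈ c.correct) (h : (c.trace w N).2 k = (c.trace w' N).2 k) :
    w k = w' k := by
  simp only [correct, Finset.mem_filter, Finset.mem_univ, true_and] at hw hw'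
  rw [← congrFun hw k, ← congrFun hw' k, estimate, estimate, h]

theorem messages_ext {w w' : Messages M} {j k : Fin 2} (h : j ≠ k) (hj : w j = w' j)
    (hk : w k = w' k) : w = w' := by
  funext l
  have : l = j ∨ l = k := by omega
  rcases this with rfl | rfl <;> assumption

theorem card_correct_le_cut (c : HalfDuplexCode n m N M) {j k : Fin 2} (h : j ≠ k) :
    c.correct.card ≤ M k * 2 ^ (N * n) := by
  let f : Messages M → Fin (M k) × (Fin N → Fin n → ZMod 2) := fun w =>
    (w k, fun s l => c.cutSignal j k w s ⟨l, by omega⟩)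
  have hf : Set.InjOn f c.correct := by
    intro w hw w' hw' hww
    obtain ⟨hk, hs⟩ := Prod.ext_iff.1 hww
    refine messages_ext h (c.eq_of_mem_correct hw hw' ?_) hk
    refine (c.trace_eq_of_cutSignal_eq h hk N fun s hsN l hl => ?_).2
    exact congrFun (congrFun hs ⟨s, hsN⟩) ⟨l, hl⟩
  have := Finset.card_le_card_of_injOn (t := Finset.univ) f (fun _ _ => Finset.mem_univ _) hf
  simpa [Finset.card_univ, ← pow_mul, mul_comm] using this

/-- The genie supplies levels `m + l` of transmitter 1. There are `n - m` of them in truncated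
subtraction, hence none when `n ≤ m`. -/
theorem card_correct_le_sum (c : HalfDuplexCode n m N M) :
    c.correct.card ≤ 2 ^ (N * (max n m + (n - m))) := by
  let f : Messages M → (Fin N → Signal (max n m)) × (Fin N → Fin (n - m) → ZMod 2) := fun w =>
    ((c.trace w N).2 0, fun s l => c.input w s 1 ⟨m + l, by omega⟩)
  have hf : Set.InjOn f c.correct := by
    intro w hw w' hw' hww
    obtain ⟨hY, hs⟩ := Prod.ext_iff.1 hww
    have hk : w 0 = w' 0 := c.eq_of_mem_correct hw hw' hY
    refine messages_ext zero_ne_one hk (c.eq_of_mem_correct hw hw' ?_)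
    rw [c.trace_eq_of_snd_eq (j := 1) (k := 0) one_ne_zero hk N hY fun s hsN l hl => ?_]
    have := congrFun (congrFun hs ⟨s, hsN⟩) ⟨l - m, by omega⟩
    simpa [f, Nat.add_sub_cancel' hl] using this
  have := Finset.card_le_card_of_injOn (t := Finset.univ) f (fun _ _ => Finset.mem_univ _) hf
  refine this.trans (le_of_eq ?_)
  simp only [Finset.card_univ, Fintype.card_prod, Fintype.card_fun, Fintype.card_fin, ZMod.card]
  rw [mul_add, pow_add]
  ring

theorem card_messages_le (c : HalfDuplexCode n m N M) (hM : ∀ k, 0 < M k)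
    (he : errorProb c.estimate ≤ 1 / 2) : M 0 * M 1 ≤ 2 * c.correct.card := by
  have hcard : Fintype.card (Messages M) = M 0 * M 1 := by
    simp [Fin.prod_univ_two]
  have hsplit := Finset.card_filter_add_card_filter_not (s := (Finset.univ : Finset (Messages M)))
    (fun w => c.estimate w = w)
  rw [Finset.card_univ, hcard] at hsplit
  rw [errorProb, hcard, div_le_iff₀ (by exact_mod_cast Nat.mul_pos (hM 0) (hM 1))] at he
  have h2 : (M 0 * M 1 : ℝ) ≤ 2 * (c.correct.card : ℝ) := by
    have h3 := congrArg (Nat.cast (R := ℝ)) hsplit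
    push_cast at he h3
    rw [correct]
    linarith
  exact_mod_cast h2

end HalfDuplexCode

/-! ### Converse: from counting to rates -/

/-- A quantity whose exponential is bounded, up to a constant, by that of `C` for arbitrarily large
block lengths is at most `C`. -/
theorem le_of_frequently_two_rpow_le {R C : ℝ}
    (h : ∃ᶠ N : ℕ in atTop, (2 : ℝ) ^ ((N : ℝ) * R) ≤ 2 * (2 : ℝ) ^ ((N : ℝ) * C)) : R ≤ C := by
  by_contra! hlt
  -- From this length on, `N * (R - C) > 1`, which beats the constant factor 2.
  obtain ⟨K, hK⟩ := exists_nat_gt (1 / (R - C))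
  obtain ⟨N, hN, hle⟩ := frequently_atTop.1 h K
  have h2 : (2 : ℝ) * 2 ^ ((N : ℝ) * C) = 2 ^ (1 + (N : ℝ) * C) := by
    rw [Real.rpow_add two_pos, Real.rpow_one]
  rw [h2, Real.rpow_le_rpow_left_iff one_lt_two] at hle
  have h3 : 1 < (K : ℝ) * (R - C) := (div_lt_iff₀ (by linarith)).1 hK
  have h4 : (K : ℝ) * (R - C) ≤ N * (R - C) :=
    mul_le_mul_of_nonneg_right (by exact_mod_cast hN) (by linarith)
  nlinarith

/-- Error probability 1/2 suffices for the converse: it costs a factor 2, which vanishes in the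
rate. -/
theorem HalfDuplexAchievable.frequently {n m : ℕ} {t : ℝ} {R : Fin 2 → ℝ≥0}
    (h : HalfDuplexAchievable n m t R) :
    ∃ᶠ N : ℕ in atTop, ∃ (M : Fin 2 → ℕ) (c : HalfDuplexCode n m N M),
      (∀ k, 0 < M k) ∧ (∀ k, (2 : ℝ) ^ ((N : ℝ) * (R k : ℝ)) ≤ (M k : ℝ)) ∧
        M 0 * M 1 ≤ 2 * c.correct.card := by
  refine ((h (1 / 2) (by norm_num)).mono ?_).frequently
  rintro N ⟨M, c, hM, he, -⟩
  have hpos : ∀ k, 0 < M k := fun k => by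
    exact_mod_cast (Real.rpow_pos_of_pos two_pos _).trans_le (hM k)
  exact ⟨M, c, hpos, hM, c.card_messages_le hpos he⟩

/-- Cut-set bound: each user gets at most the rate of the direct link. -/
theorem HalfDuplexAchievable.le_direct {n m : ℕ} {t : ℝ} {R : Fin 2 → ℝ≥0}
    (h : HalfDuplexAchievable n m t R) (j : Fin 2) : (R j : ℝ) ≤ n := by
  obtain ⟨k, hjk⟩ : ∃ k : Fin 2, j ≠ k := ⟨j + 1, by fin_cases j <;> simp⟩
  refine le_of_frequently_two_rpow_le (h.frequently.mono ?_)
  rintro N ⟨M, c, hpos, hM, hc⟩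
  have h1 : M k * M j ≤ M k * (2 * 2 ^ (N * n)) := by
    calc M k * M j = M 0 * M 1 := by fin_cases j <;> fin_cases k <;> simp_all [mul_comm]
      _ ≤ 2 * (M k * 2 ^ (N * n)) := hc.trans (Nat.mul_le_mul_left _ (c.card_correct_le_cut hjk))
      _ = _ := by ring
  have h2 := Nat.le_of_mul_le_mul_left h1 (hpos k)
  refine (hM j).trans ?_
  rw [← Nat.cast_mul, Real.rpow_natCast]
  exact_mod_cast h2

/-- Sum-rate bound: it holds even if all outputs are fed back to both transmitters. -/
theorem HalfDuplexAchievable.add_le {n m : ℕ} {t : ℝ} {R : Fin 2 → ℝ≥0}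
    (h : HalfDuplexAchievable n m t R) : (R 0 + R 1 : ℝ) ≤ (max n m + (n - m) : ℕ) := by
  refine le_of_frequently_two_rpow_le (h.frequently.mono ?_)
  rintro N ⟨M, c, hpos, hM, hc⟩
  rw [mul_add, Real.rpow_add two_pos, ← Nat.cast_mul, Real.rpow_natCast]
  refine (mul_le_mul (hM 0) (hM 1) (by positivity) (by positivity)).trans ?_
  exact_mod_cast hc.trans (Nat.mul_le_mul_left _ c.card_correct_le_sum)

theorem sumCapacity_closure_le {A : Set (Fin 2 → ℝ≥0)} {C : ℝ≥0} (h : ∀ R ∈ A, R 0 + R 1 ≤ C) :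
    sumCapacity (closure A) ≤ C := by
  have hcl : IsClosed {R : Fin 2 → ℝ≥0 | R 0 + R 1 ≤ C} :=
    isClosed_le (by fun_prop) continuous_const
  refine iSup₂_le fun R hR => ?_
  exact_mod_cast closure_minimal h hcl hR

theorem halfDuplexSumCapacity_le {n m C : ℕ} (hC : min (2 * n) (max n m + (n - m)) ≤ C) :
    halfDuplexSumCapacity n m ≤ (C : ℝ≥0) := by
  refine iSup₂_le fun t _ => sumCapacity_closure_le fun R hR => ?_
  have h0 := HalfDuplexAchievable.le_direct hR 0
  have h1 := HalfDuplexAchievable.le_direct hR 1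
  have h2 := HalfDuplexAchievable.add_le hR
  rw [← NNReal.coe_le_coe]
  push_cast
  rcases min_le_iff.1 hC with h | h
  · have : ((2 * n : ℕ) : ℝ) ≤ C := by exact_mod_cast h
    push_cast at this
    linarith
  · exact h2.trans (by exact_mod_cast h)

/-! ### Codes without feedback as half-duplex codes -/

/-- The half-duplex code that uses the forward channel in every slot. -/
def NoFeedbackCode.toHalfDuplex {n m N : ℕ} {M : Fin 2 → ℕ} (c : NoFeedbackCode n m N M) :
    HalfDuplexCode n m N M where
  isForward _ := true
  enc k i w _ := if h : i < N then c.enc k w ⟨i, h⟩ else 0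
  fb _ _ _ := 0
  dec := c.dec

namespace NoFeedbackCode

variable {n m N : ℕ} {M : Fin 2 → ℕ}

theorem toHalfDuplex_trace (c : NoFeedbackCode n m N M) (w : Messages M) (k : Fin 2) (i : ℕ)
    (hi : i ≤ N) : (c.toHalfDuplex.trace w i).2 k =
      fun s : Fin i => channel n m (fun l => c.enc l (w l) ⟨s, by omega⟩) k := by
  induction i with
  | zero => exact funext fun s => s.elim0
  | succ i ih =>
    rw [HalfDuplexCode.trace_succ_snd, ih (by omega)]
    funext s
    refine Fin.lastCases ?_ (fun s => ?_) s
    · have : i < N := by omega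
      have hx : c.toHalfDuplex.input w i = fun l => c.enc l (w l) ⟨i, this⟩ :=
        funext fun l => dif_pos this
      simp [hx, show c.toHalfDuplex.isForward i = true from rfl]
    · simp

theorem toHalfDuplex_estimate (c : NoFeedbackCode n m N M) :
    c.toHalfDuplex.estimate = c.estimate := by
  funext w k
  rw [HalfDuplexCode.estimate, toHalfDuplex_trace c w k N le_rfl]
  rfl

end NoFeedbackCode

theorem NoFeedbackAchievable.halfDuplex {n m : ℕ} {R : Fin 2 → ℝ≥0}
    (h : NoFeedbackAchievable n m R) : HalfDuplexAchievable n m 1 R := by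
  intro ε hε
  -- Length 0 is excluded: there the forward fraction is 0/0 = 0, not 1.
  filter_upwards [h ε hε, eventually_gt_atTop 0] with N hN hpos
  obtain ⟨M, c, hM, he⟩ := hN
  refine ⟨M, c.toHalfDuplex, hM, by rwa [c.toHalfDuplex_estimate], ?_⟩
  have hN0 : (N : ℝ) ≠ 0 := by positivity
  have : c.toHalfDuplex.forwardFraction = 1 := by
    simp [HalfDuplexCode.forwardFraction, NoFeedbackCode.toHalfDuplex, hN0]
  rw [this]
  simpa using hε.le

theorem noFeedbackSumCapacity_le_halfDuplex (n m : ℕ) :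
    noFeedbackSumCapacity n m ≤ halfDuplexSumCapacity n m := by
  refine le_trans ?_ (le_iSup₂ (f := fun t (_ : t ∈ Set.Icc (0 : ℝ) 1) =>
    sumCapacity (halfDuplexRegion n m t)) 1 (by simp))
  exact biSup_mono fun R hR => closure_mono (fun _ h => h.halfDuplex) hR

/-! ### Achievability by one-shot codes -/

/-- Repeating a one-shot code with zero error in every slot. -/
theorem noFeedbackAchievable_of_injective {n m : ℕ} {r : Fin 2 → ℕ}
    (e : ∀ k, (Fin (r k) → ZMod 2) → Signal (max n m))
    (h : ∀ (u u' : ∀ k, Fin (r k) → ZMod 2) (j : Fin 2),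
      channel n m (fun k => e k (u k)) j = channel n m (fun k => e k (u' k)) j → u j = u' j) :
    NoFeedbackAchievable n m fun k => (r k : ℝ≥0) := by
  intro ε hε
  refine Eventually.of_forall fun N => ?_
  let U : Fin 2 → Type := fun k => Fin N → Fin (r k) → ZMod 2
  let M : Fin 2 → ℕ := fun k => Fintype.card (U k)
  let φ : ∀ k, Fin (M k) ≃ U k := fun k => (Fintype.equivFin (U k)).symm
  let out : Messages M → Fin 2 → Fin N → Signal (max n m) :=
    fun w j i => channel n m (fun l => e l (φ l (w l) i)) j
  have hout : ∀ w w' j, out w j = out w' j → w j = w' j := by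
    intro w w' j hw
    apply (φ j).injective
    funext i
    exact h (fun l => φ l (w l) i) (fun l => φ l (w' l) i) j (congrFun hw i)
  have hdec : ∀ j, ∃ d : (Fin N → Signal (max n m)) → Fin (M j), ∀ w, d (out w j) = w j := by
    intro j
    -- Fallback for output words that no message pair produces.
    have w₀ : Messages M := fun k => (φ k).symm 0
    classical
    refine ⟨fun y => if hy : ∃ w, out w j = y then hy.choose j else w₀ j, fun w => ?_⟩
    have hy : ∃ w', out w' j = out w j := ⟨w, rfl⟩
    beta_reduce
    rw [dif_pos hy]
    exact hout _ _ j hy.choose_spec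
  choose d hd using hdec
  refine ⟨M, ⟨fun k w i => e k (φ k w i), d⟩, fun k => ?_, ?_⟩
  · refine le_of_eq ?_
    simp only [M, U, Fintype.card_fun, Fintype.card_fin, ZMod.card, NNReal.coe_natCast]
    rw [← Nat.cast_mul, Real.rpow_natCast, mul_comm, pow_mul]
    push_cast
    rfl
  · have : ∀ w, NoFeedbackCode.estimate (n := n) (m := m)
        ⟨fun k w i => e k (φ k w i), d⟩ w = w := fun w => funext fun k => hd k w
    simp [errorProb, this, hε.le]

/-- Level `i` of the signal received over links that carry `a` and `b` of `q` levels. -/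
def levelOutput (q a b : ℕ) (x y : ℕ → ZMod 2) (i : ℕ) : ZMod 2 :=
  (if q - a ≤ i then x (i - (q - a)) else 0) + if q - b ≤ i then y (i - (q - b)) else 0

/-- A string of `r` bits, extended by zeros. -/
def extendZero {r : ℕ} (u : Fin r → ZMod 2) (i : ℕ) : ZMod 2 :=
  if h : i < r then u ⟨i, h⟩ else 0

/-- Achievability by a one-shot code that is described level by level. -/
theorem noFeedbackAchievable_of_levels {n m : ℕ} {r : Fin 2 → ℕ}
    (E : Fin 2 → (ℕ → ZMod 2) → ℕ → ZMod 2)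
    (h : ∀ u u' : Fin 2 → ℕ → ZMod 2, (∀ k i, r k ≤ i → u k i = 0) →
      (∀ k i, r k ≤ i → u' k i = 0) → ∀ j k : Fin 2, j ≠ k →
      (∀ i < max n m, levelOutput (max n m) n m (E j (u j)) (E k (u k)) i =
        levelOutput (max n m) n m (E j (u' j)) (E k (u' k)) i) → ∀ b < r j, u j b = u' j b) :
    NoFeedbackAchievable n m fun k => (r k : ℝ≥0) := by
  refine noFeedbackAchievable_of_injective (fun k u i => E k (extendZero u) i) ?_
  intro u u' j hY
  obtain ⟨k, hjk⟩ : ∃ k : Fin 2, j ≠ k := ⟨j + 1, by fin_cases j <;> simp⟩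
  rw [channel_of_ne _ hjk, channel_of_ne _ hjk] at hY
  funext b
  have := h (fun k => extendZero (u k)) (fun k => extendZero (u' k))
    (fun k i hi => dif_neg (by omega)) (fun k i hi => dif_neg (by omega)) j k hjk
    (fun i hi => ?_) b b.2
  · simpa [extendZero] using this
  · have := congrFun hY ⟨i, hi⟩
    simpa only [Pi.add_apply, shiftMatrix_mulVec_apply, levelOutput] using this

theorem le_noFeedbackSumCapacity {n m : ℕ} {r : Fin 2 → ℕ}
    (h : NoFeedbackAchievable n m fun k => (r k : ℝ≥0)) :
    ((r 0 + r 1 : ℕ) : ℝ≥0) ≤ noFeedbackSumCapacity n m := by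
  refine le_trans (le_of_eq ?_) (le_iSup₂ (f := fun (R : Fin 2 → ℝ≥0)
    (_ : R ∈ noFeedbackRegion n m) => ((R 0 + R 1 : ℝ≥0) : ℝ≥0∞)) _ (subset_closure h))
  push_cast
  rfl

/-- Bits repeated with period `p` can all be read off any `p` consecutive levels. -/
theorem exists_mod_eq_of_window (a : ℕ) {p c : ℕ} (hc : c < p) :
    ∃ j, a ≤ j ∧ j < a + p ∧ j % p = c := by
  have hp : 0 < p := by omega
  have ha := Nat.mod_lt a hp
  refine ⟨a + (c + (p - a % p)) % p, by omega, by have := Nat.mod_lt (c + (p - a % p)) hp; omega, ?_⟩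
  rw [Nat.add_mod_mod, Nat.add_mod, ← Nat.add_mod]
  have h1 := Nat.div_add_mod a p
  have h2 : a + (c + (p - a % p)) = c + p * (a / p + 1) := by
    rw [mul_add]
    omega
  rw [h2, Nat.add_mul_mod_self_left, Nat.mod_eq_of_lt hc]

/-- Very strong interference: both users use all levels of their direct links. -/
theorem noFeedbackAchievable_of_two_mul_le {n m : ℕ} (hm : 2 * n ≤ m) :
    NoFeedbackAchievable n m fun k => ((![n, n] k : ℕ) : ℝ≥0) := by
  refine noFeedbackAchievable_of_levels (fun _ u => u) ?_
  have hr : ∀ k : Fin 2, ![n, n] k = n := fun k => by fin_cases k <;> rfl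
  simp only [hr, max_eq_right (show n ≤ m by omega)]
  intro u u' hu hu' j k _ hY b hb
  -- Bit `b` arrives here over the direct link; the interferer's level `b + (m - n) ≥ n` is empty.
  have := hY (b + (m - n)) (by omega)
  simpa [levelOutput, hu k (b + (m - n)) (by omega), hu' k (b + (m - n)) (by omega)] using this

/-- Strong interference: user `0` uses all levels of its direct link, user `1` sends the same
`m - n` bits on its first levels and, cyclically shifted, on its last ones. -/
theorem noFeedbackAchievable_of_le {n m : ℕ} (hnm : n ≤ m) (hm : m ≤ 2 * n) :
    NoFeedbackAchievable n m fun k => ((![n, m - n] k : ℕ) : ℝ≥0) := by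
  obtain ⟨d, rfl⟩ := Nat.exists_eq_add_of_le hnm
  -- The two blocks may overlap; indexing by `i % d` makes them agree there.
  refine noFeedbackAchievable_of_levels ![fun u => u, fun v i =>
    if i < d ∨ (n ≤ i + d ∧ i < n) then v (i % d) else 0] ?_
  intro u u' hu hu' j k hjk
  have hu0 := hu 0
  have hu0' := hu' 0
  simp only [max_eq_right hnm, Matrix.cons_val_zero] at hu0 hu0' ⊢
  fin_cases j <;> fin_cases k <;> simp at hjk ⊢
  · intro hY b hb
    -- The direct link does not reach the top `d` levels, so the interfering bits arrive there
    -- alone.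
    have hv : ∀ c < d, u 1 c = u' 1 c := by
      intro c hc
      have := hY c (by omega)
      simpa [levelOutput, Nat.not_le.2 hc, hc, Nat.mod_eq_of_lt hc] using this
    have := hY (b + d) (by omega)
    simp only [levelOutput, Nat.add_sub_cancel_left, Nat.le_add_left, if_true,
      Nat.add_sub_cancel, Nat.sub_self, Nat.zero_le, Nat.sub_zero] at this
    split_ifs at this with h'
    · rw [hv _ (Nat.mod_lt _ (by omega))] at this
      exact add_right_cancel this
    · exact add_right_cancel this
  · intro hY c hc
    -- The last block lands on levels from `n` on, beyond the bits of user 0.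
    obtain ⟨i, h1, h2, h3⟩ := exists_mod_eq_of_window (n - d) hc
    have := hY (i + d) (by omega)
    have hi : i < d ∨ (n ≤ i + d ∧ i < n) := by omega
    simp only [levelOutput, Nat.add_sub_cancel_left, Nat.le_add_left, if_true,
      Nat.add_sub_cancel, Nat.sub_self, Nat.zero_le, Nat.sub_zero, hi, h3,
      hu0 (i + d) (by omega), hu0' (i + d) (by omega)] at this
    exact add_right_cancel this

/-- Moderately weak interference, with `p = n - m`: user `0` leaves its last `p` common levels
unused; user `1` sends `p` bits on its first levels, and again so that they reach the other receiver
on these unused levels, and `p` further bits on its private levels. -/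
theorem noFeedbackAchievable_of_lt {n m : ℕ} (hnm : m < n) (hm : 2 * n ≤ 3 * m) :
    NoFeedbackAchievable n m fun k => ((![m, 2 * (n - m)] k : ℕ) : ℝ≥0) := by
  obtain ⟨p, rfl⟩ := Nat.exists_eq_add_of_le hnm.le
  -- The hypothesis amounts to `2 * p ≤ m`, so the second block, levels `m - 2p` to `m - p - 1`,
  -- fits. The cross link moves it down by `p`, onto the gap of user 0.
  refine noFeedbackAchievable_of_levels ![
    fun u i => if i < m - p then u i else if i < m then 0 else u (i - p),
    fun v i => if i < p ∨ (m ≤ i + 2 * p ∧ i < m - p) then v (i % p)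
      else if i < m then 0 else v (i - m + p)] ?_
  intro u u' _ _ j k hjk
  simp only [max_eq_left hnm.le]
  fin_cases j <;> fin_cases k <;> simp at hjk ⊢
  · intro hY b hb
    simp only [levelOutput, Nat.sub_self, Nat.zero_le, if_true, Nat.sub_zero,
      Nat.add_sub_cancel_left] at hY
    have hv : ∀ c < p, u 1 c = u' 1 c := by
      intro c hc
      obtain ⟨i, h1, h2, h3⟩ := exists_mod_eq_of_window (m - 2 * p) hc
      have := hY (i + p) (by omega)
      have hi : i < p ∨ (m ≤ i + 2 * p ∧ i < m - p) := by omega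
      simpa [hi, h3, show ¬ i + p < m - p by omega, show i + p < m by omega] using this
    rcases lt_or_ge b (m - p) with h | h
    · have := hY b (by omega)
      simp only [h, if_true] at this
      split_ifs at this
      · rw [hv _ (Nat.mod_lt _ (by omega))] at this
        exact add_right_cancel this
      all_goals first | omega | exact add_right_cancel this
    -- Private levels of user 0 meet levels `m - p` to `m - 1` of user 1, which are empty.
    · have := hY (b + p) (by omega)
      simpa [show ¬ b + p < m - p by omega, show ¬ b + p < m by omega, hb,
        show ¬ (b < p ∨ (m ≤ b + 2 * p ∧ b < m - p)) by omega] using this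
  · intro hY c hc
    simp only [levelOutput, Nat.sub_self, Nat.zero_le, if_true, Nat.sub_zero,
      Nat.add_sub_cancel_left] at hY
    rcases lt_or_ge c p with h | h
    · have := hY c (by omega)
      simpa [h, Nat.mod_eq_of_lt h, Nat.not_le.2 h] using this
    -- Private levels of user 1 meet the gap of user 0.
    · have := hY (m + (c - p)) (by omega)
      simpa [show ¬ (m + (c - p) < p ∨ (m ≤ m + (c - p) + 2 * p ∧ m + (c - p) < m - p)) by omega,
        show p ≤ m + (c - p) by omega, show ¬ m + (c - p) - p < m - p by omega,
        show m + (c - p) - p < m by omega, h] using this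

end DetIC

theorem theorem4 (n m : ℕ) (hm : (2 / 3 : ℝ) * (n : ℝ) ≤ (m : ℝ)) :
    DetIC.halfDuplexSumCapacity n m = DetIC.noFeedbackSumCapacity n m := by
  refine le_antisymm ?_ (DetIC.noFeedbackSumCapacity_le_halfDuplex n m)
  have hm' : 2 * n ≤ 3 * m := by
    have : (2 * n : ℝ) ≤ 3 * m := by linarith
    exact_mod_cast this
  -- The sum rates attained in the three regimes are `2n - m`, `m` and `2n`.
  rcases lt_or_ge m n with h | h
  · refine le_trans (DetIC.halfDuplexSumCapacity_le ?_)
      (DetIC.le_noFeedbackSumCapacity (DetIC.noFeedbackAchievable_of_lt h hm'))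
    simp
    omega
  rcases le_total m (2 * n) with h' | h'
  · refine le_trans (DetIC.halfDuplexSumCapacity_le ?_)
      (DetIC.le_noFeedbackSumCapacity (DetIC.noFeedbackAchievable_of_le h h'))
    simp
    omega
  · refine le_trans (DetIC.halfDuplexSumCapacity_le ?_)
      (DetIC.le_noFeedbackSumCapacity (DetIC.noFeedbackAchievable_of_two_mul_le h'))
    simp
    omega
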